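/- Let $1\le K\le n$ be integers and let $\mathcal C$ be a non-empty finite class of subsets of $\{1,\dots,n\}$, each of cardinality $K$; put $N=|\mathcal C|$. For $\mu>0$ let $\mathbb P_0$ be the law on $\mathbb R^n$ of a vector with i.i.d. $\mathcal N(0,1)$ components and, for $S\in\mathcal C$, let $\mathbb P_S$ be the law of a vector with independent components, the $i$-th being $\mathcal N(\mu,1)$ if $i\in S$ and $\mathcal N(0,1)$ if $i\notin S$; let $\phi_0$ and $\phi_S$ be the corresponding Lebesgue densities. The risk of a test $f:\mathbb R^n\to\{0,1\}$ is $$R(f)=\mathbb P_0\{f=1\}+\frac1N\sum_{S\in\mathcal C}\mathbb P_S\{f=0\},$$ and $R^*=R^*_{\mathcal C}(\mu)=R(f^*)$ denotes the risk of the optimal test $f^*$, where $f^*(x)=1$ if $\frac1N\sum_{S\in\mathcal C}\phi_S(x)/\phi_0(x)>1$ and $f^*(x)=0$ otherwise. Assume that $\mathcal C$ is symmetric in the following sense. Let $S,S'$ be drawn independently and uniformly at random from $\mathcal C$; then (i) the conditional distribution of $|S\cap S'|$ given $S'=T$ is the same for all $T\in\mathcal C$; and (ii) for every $S_0\in\mathcal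 C$ and every $i\in S_0$, $\mathbb P\{i\in S\}=K/n$. Assume moreover that $|\mathcal C|\le n^{\alpha}$ for some real $\alpha>0$. Then $R^*\ge \tfrac12$ for all $\mu>0$ with $$\mu\le\sqrt{\frac1K\log\Bigl(1+\frac nK\Bigr)},$$ and $R^*\le\tfrac12$ for all $\mu>0$ with $$\mu\ge\sqrt{\frac{2\alpha}{K}\log n}+\sqrt{\frac{8\log 4}{K}}.$$ -/

import Mathlib

open MeasureTheory ProbabilityTheory

noncomputable section

namespace SubsetDetection

variable {n : ℕ}

/-- The law of the observation under the null hypothesis: `n` i.i.d. standard normal components. -/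
def nullLaw (n : ℕ) : Measure (Fin n → ℝ) :=
  Measure.pi fun _ => gaussianReal 0 1

/-- The law of the observation when `S` is the contaminated set: independent components, with
distribution `N(μ, 1)` for `i ∈ S` and `N(0, 1)` for `i ∉ S`. -/
def altLaw (μ : ℝ) (S : Finset (Fin n)) : Measure (Fin n → ℝ) :=
  Measure.pi fun i => gaussianReal (if i ∈ S then μ else 0) 1

/-- The risk of a test `f` for the class `C`: the type I error plus the type II error averaged
over `C`. -/
def risk (C : Finset (Finset (Fin n))) (μ : ℝ) (f : (Fin n → ℝ) → Fin 2) : ℝ :=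
  (nullLaw n).real {x | f x = 1} + (1 / (C.card : ℝ)) * ∑ S ∈ C, (altLaw μ S).real {x | f x = 0}

/-- The density of the null law. -/
def nullDensity (x : Fin n → ℝ) : ℝ :=
  ∏ i, gaussianPDFReal 0 1 (x i)

/-- The density of the law with contaminated set `S`. -/
def altDensity (μ : ℝ) (S : Finset (Fin n)) (x : Fin n → ℝ) : ℝ :=
  ∏ i, gaussianPDFReal (if i ∈ S then μ else 0) 1 (x i)

/-- The likelihood ratio of the uniform mixture of the alternatives against the null law. -/
def likelihoodRatio (C : Finset (Finset (Fin n))) (μ : ℝ) (x : Fin n → ℝ) : ℝ :=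
  ((1 / (C.card : ℝ)) * ∑ S ∈ C, altDensity μ S x) / nullDensity x

/-- The optimal (likelihood ratio) test. -/
def optimalTest (C : Finset (Finset (Fin n))) (μ : ℝ) (x : Fin n → ℝ) : Fin 2 :=
  if 1 < likelihoodRatio C μ x then 1 else 0

/-- The Bayes risk `R*`, the risk of the optimal test. -/
def bayesRisk (C : Finset (Finset (Fin n))) (μ : ℝ) : ℝ :=
  risk C μ (optimalTest C μ)

/-- Subsets of a finite index set form a finite discrete space. -/
instance instMeasurableSpaceFinsetFin : MeasurableSpace (Finset (Fin n)) := ⊤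

/-- The law of a uniformly random element `S` of `C`. -/
def uniformLaw (C : Finset (Finset (Fin n))) : Measure (Finset (Fin n)) :=
  uniformOn (C : Set (Finset (Fin n)))

/-- The law of a pair `(S, S')` of independent uniformly random elements of `C`. -/
def pairLaw (C : Finset (Finset (Fin n))) : Measure (Finset (Fin n) × Finset (Fin n)) :=
  (uniformLaw C).prod (uniformLaw C)

/-- The symmetry conditions on a class `C` of sets of cardinality `K`. -/
structure IsSymmetricClass (C : Finset (Finset (Fin n))) (K : ℕ) : Prop where
  /-- The conditional distribution of `|S ∩ S'|` given `S' = T` is the same for all `T ∈ C`. -/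
  overlap : ∀ T ∈ C, ∀ T' ∈ C, ∀ z : ℕ,
    (pairLaw C)[{p | (p.1 ∩ p.2).card = z} | {p | p.2 = T}] =
      (pairLaw C)[{p | (p.1 ∩ p.2).card = z} | {p | p.2 = T'}]
  /-- Every index covered by the class lies in `S` with probability `K / n`. -/
  inclusion : ∀ S₀ ∈ C, ∀ i ∈ S₀, (uniformLaw C).real {S | i ∈ S} = (K : ℝ) / n

end SubsetDetection

end

/-!
With `L` the likelihood ratio, the Bayes risk is the integral of `min 1 L` under the null law.

For the lower bound, `min 1 L = (1 + L - |L - 1|) / 2` and Cauchy-Schwarz give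
`R* ≥ 1 - √(E L² - 1) / 2`. The product of two Cameron-Martin densities is a multiple of a third
one, so `E L²` is the mean of `exp (μ² |S ∩ S'|)` over independent uniform `S`, `S'` in the class.
Bounding `exp` by its chord on `[0, μ² K]` replaces `|S ∩ S'|` by its mean given `S`, which the
inclusion probabilities control, and `E L² ≤ 2` follows once `exp (μ² K) ≤ 1 + n / K`.

For the upper bound, no test does better than the optimal one, and the scan test is good enough:
its type I error is controlled by a union bound over the class, its type II error by the single
sum over the contaminated set, both through the sub-Gaussian tail of a sum of `K` components.
Splitting the threshold as `K (√(2 log N / K) + √(2 log (2 / δ) / K))` makes each error at most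
`δ / 2`.
-/

namespace SubsetDetection

open scoped ENNReal NNReal Finset

section BayesTesting

variable {Ω : Type*} [MeasurableSpace Ω] {P : Measure Ω} {f g : Ω → ℝ}

lemma integral_min_le_setIntegral_add_compl (hf : Integrable f P) (hg : Integrable g P)
    {A : Set Ω} (hA : MeasurableSet A) :
    ∫ x, min (f x) (g x) ∂P ≤ ∫ x in A, f x ∂P + ∫ x in Aᶜ, g x ∂P := by
  have hmin : Integrable (fun x => min (f x) (g x)) P := hf.inf hg
  rw [← integral_add_compl hA hmin]
  exact add_le_add
    (setIntegral_mono hmin.integrableOn hf.integrableOn fun x => min_le_left _ _)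
    (setIntegral_mono hmin.integrableOn hg.integrableOn fun x => min_le_right _ _)

lemma integral_min_eq_setIntegral_add_compl (hf : Integrable f P) (hg : Integrable g P)
    (hA : MeasurableSet {x | f x < g x}) :
    ∫ x, min (f x) (g x) ∂P =
      ∫ x in {x | f x < g x}, f x ∂P + ∫ x in {x | f x < g x}ᶜ, g x ∂P := by
  have hmin : Integrable (fun x => min (f x) (g x)) P := hf.inf hg
  rw [← integral_add_compl hA hmin]
  congr 1
  · exact setIntegral_congr_fun hA fun x hx => min_eq_left (le_of_lt hx)
  · exact setIntegral_congr_fun hA.compl fun x hx => min_eq_right (not_lt.1 hx)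

lemma sq_integral_le_integral_sq [IsProbabilityMeasure P] (hf : MemLp f 2 P) :
    (∫ x, f x ∂P) ^ 2 ≤ ∫ x, f x ^ 2 ∂P := by
  have h := variance_nonneg f P
  rw [variance_eq_sub hf] at h
  exact sub_nonneg.1 h

lemma one_sub_sqrt_variance_div_two_le_integral_min [IsProbabilityMeasure P] (hg : MemLp g 2 P)
    (hmean : ∫ x, g x ∂P = 1) : 1 - √Var[g; P] / 2 ≤ ∫ x, min 1 (g x) ∂P := by
  have hint : Integrable g P := hg.integrable one_le_two
  have hdev : MemLp (fun x => |g x - 1|) 2 P := (hg.sub (memLp_const 1)).abs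
  have hmin : ∫ x, min 1 (g x) ∂P = 1 - (∫ x, |g x - 1| ∂P) / 2 := by
    have h (x : Ω) : min 1 (g x) = (1 + g x - |g x - 1|) / 2 := by
      rw [inf_eq_half_smul_add_sub_abs_sub' ℝ, smul_eq_mul]
      ring
    simp only [h]
    rw [integral_div, integral_sub (by fun_prop) (hdev.integrable one_le_two),
      integral_add (by fun_prop) hint, hmean, integral_const, probReal_univ, one_smul]
    ring
  have hle : ∫ x, |g x - 1| ∂P ≤ √Var[g; P] := by
    refine Real.le_sqrt_of_sq_le ((sq_integral_le_integral_sq hdev).trans_eq ?_)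
    simp only [sq_abs, variance_eq_integral hg.aemeasurable, hmean]
  linarith

end BayesTesting

lemma pi_withDensity_eq_withDensity_prod {ι : Type*} [Fintype ι] {X : ι → Type*}
    [∀ i, MeasurableSpace (X i)] {ν : ∀ i, Measure (X i)} [∀ i, IsProbabilityMeasure (ν i)]
    {f : ∀ i, X i → ℝ≥0∞} (hf : ∀ i, Measurable (f i))
    [∀ i, SigmaFinite ((ν i).withDensity (f i))] :
    Measure.pi (fun i => (ν i).withDensity (f i)) =
      (Measure.pi ν).withDensity fun x => ∏ i, f i (x i) := by
  classical
  refine Measure.pi_eq fun s hs => ?_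
  have hmeas (i : ι) : Measurable ((s i).indicator (f i)) := (hf i).indicator (hs i)
  have hindicator (x : ∀ i, X i) : (Set.univ.pi s).indicator (fun x => ∏ i, f i (x i)) x =
      ∏ i, (s i).indicator (f i) (x i) := by
    simp only [Set.indicator_apply, Set.mem_univ_pi, Finset.prod_ite_zero, Finset.mem_univ,
      forall_const]
  calc (Measure.pi ν).withDensity (fun x => ∏ i, f i (x i)) (Set.univ.pi s)
      = ∫⁻ x, ∏ i, (s i).indicator (f i) (x i) ∂Measure.pi ν := by
        rw [withDensity_apply _ (.univ_pi hs), ← lintegral_indicator (.univ_pi hs)]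
        simp only [hindicator]
    _ = ∏ i, ∫⁻ x, (s i).indicator (f i) (x i) ∂Measure.pi ν :=
        lintegral_prod_eq_prod_lintegral_of_indepFun _ _
          (iIndepFun_pi fun i => (hmeas i).aemeasurable)
          fun i => (hmeas i).comp (measurable_pi_apply i)
    _ = ∏ i, (ν i).withDensity (f i) (s i) := by
        refine Finset.prod_congr rfl fun i _ => ?_
        rw [(measurePreserving_eval ν i).lintegral_comp (hmeas i), lintegral_indicator (hs i),
          withDensity_apply _ (hs i)]

section GaussianReal

lemma gaussianPDFReal_eq_mul_exp (m : ℝ) (v : ℝ≥0) (x : ℝ) :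
    gaussianPDFReal m v x = gaussianPDFReal 0 v x * Real.exp ((m * x - m ^ 2 / 2) / v) := by
  simp only [gaussianPDFReal, mul_assoc, ← Real.exp_add]
  congr 2
  ring

lemma gaussianReal_eq_withDensity (m : ℝ) {v : ℝ≥0} (hv : v ≠ 0) :
    gaussianReal m v = (gaussianReal 0 v).withDensity
      fun x => ENNReal.ofReal (Real.exp ((m * x - m ^ 2 / 2) / v)) := by
  rw [gaussianReal_of_var_ne_zero _ hv, gaussianReal_of_var_ne_zero _ hv,
    ← withDensity_mul _ (measurable_gaussianPDF _ _) (by fun_prop)]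
  congr 1 with x
  rw [Pi.mul_apply, gaussianPDF, gaussianPDF, gaussianPDFReal_eq_mul_exp,
    ENNReal.ofReal_mul (gaussianPDFReal_nonneg _ _ _)]

lemma hasSubgaussianMGF_sub_mean_gaussianReal (m : ℝ) (v : ℝ≥0) :
    HasSubgaussianMGF (fun x => x - m) v (gaussianReal m v) := by
  rw [← HasSubgaussianMGF.id_map_iff (by fun_prop), gaussianReal_map_sub_const, sub_self]
  refine ⟨fun t => integrable_exp_mul_gaussianReal t, fun t => ?_⟩
  simp only [mgf_id_gaussianReal, zero_mul, zero_add, le_refl]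

end GaussianReal

section GaussianShift

variable {ι : Type*} [Fintype ι]

/-- The law of a vector with independent components, the `i`-th being `N(a i, 1)`. Both `nullLaw`
and `altLaw` unfold to it. -/
noncomputable def gaussianShift (a : ι → ℝ) : Measure (ι → ℝ) :=
  Measure.pi fun i => gaussianReal (a i) 1

/-- The Cameron-Martin density of `gaussianShift a` with respect to `gaussianShift 0`. -/
noncomputable def shiftDensity (a x : ι → ℝ) : ℝ :=
  Real.exp (a ⬝ᵥ x - a ⬝ᵥ a / 2)

instance (a : ι → ℝ) : IsProbabilityMeasure (gaussianShift a) := by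
  unfold gaussianShift
  infer_instance

lemma shiftDensity_nonneg (a x : ι → ℝ) : 0 ≤ shiftDensity a x := Real.exp_nonneg _

@[fun_prop]
lemma measurable_shiftDensity (a : ι → ℝ) : Measurable (shiftDensity a) := by
  unfold shiftDensity dotProduct
  fun_prop

lemma prod_exp_eq_shiftDensity (a x : ι → ℝ) :
    ∏ i, Real.exp (a i * x i - a i ^ 2 / 2) = shiftDensity a x := by
  simp only [← Real.exp_sum, shiftDensity, dotProduct, Finset.sum_sub_distrib, Finset.sum_div, sq]

lemma prod_gaussianPDFReal_eq_mul_shiftDensity (a x : ι → ℝ) :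
    ∏ i, gaussianPDFReal (a i) 1 (x i) = (∏ i, gaussianPDFReal 0 1 (x i)) * shiftDensity a x := by
  rw [← prod_exp_eq_shiftDensity, ← Finset.prod_mul_distrib]
  refine Finset.prod_congr rfl fun i _ => ?_
  rw [gaussianPDFReal_eq_mul_exp, NNReal.coe_one, div_one]

lemma gaussianShift_eq_withDensity (a : ι → ℝ) :
    gaussianShift a =
      (gaussianShift 0).withDensity fun x => ENNReal.ofReal (shiftDensity a x) := by
  have hcoord (i : ι) := gaussianReal_eq_withDensity (a i) one_ne_zero
  simp only [NNReal.coe_one, div_one] at hcoord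
  have hfinite (i : ι) : SigmaFinite ((gaussianReal 0 1).withDensity
      fun x => ENNReal.ofReal (Real.exp (a i * x - a i ^ 2 / 2))) := by
    rw [← hcoord i]
    infer_instance
  simp only [gaussianShift, hcoord]
  rw [pi_withDensity_eq_withDensity_prod fun i => by fun_prop]
  simp only [← ENNReal.ofReal_prod_of_nonneg fun _ _ => Real.exp_nonneg _,
    prod_exp_eq_shiftDensity, Pi.zero_apply]

lemma lintegral_shiftDensity (a : ι → ℝ) :
    ∫⁻ x, ENNReal.ofReal (shiftDensity a x) ∂gaussianShift 0 = 1 := by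
  rw [← setLIntegral_univ, ← withDensity_apply _ .univ, ← gaussianShift_eq_withDensity,
    measure_univ]

lemma integrable_shiftDensity (a : ι → ℝ) : Integrable (shiftDensity a) (gaussianShift 0) :=
  (lintegral_ofReal_ne_top_iff_integrable (measurable_shiftDensity a).aestronglyMeasurable
    (ae_of_all _ (shiftDensity_nonneg a))).1 (by simp [lintegral_shiftDensity])

lemma gaussianShift_real_eq_setIntegral (a : ι → ℝ) {A : Set (ι → ℝ)} (hA : MeasurableSet A) :
    (gaussianShift a).real A = ∫ x in A, shiftDensity a x ∂gaussianShift 0 := by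
  rw [integral_eq_lintegral_of_nonneg_ae (ae_of_all _ (shiftDensity_nonneg a))
      (measurable_shiftDensity a).aestronglyMeasurable, measureReal_def,
    gaussianShift_eq_withDensity, withDensity_apply _ hA]

lemma integral_shiftDensity (a : ι → ℝ) : ∫ x, shiftDensity a x ∂gaussianShift 0 = 1 := by
  rw [← setIntegral_univ, ← gaussianShift_real_eq_setIntegral a .univ, probReal_univ]

lemma shiftDensity_mul_shiftDensity (a b x : ι → ℝ) :
    shiftDensity a x * shiftDensity b x = Real.exp (a ⬝ᵥ b) * shiftDensity (a + b) x := by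
  simp only [shiftDensity, ← Real.exp_add, add_dotProduct, dotProduct_add, dotProduct_comm b a]
  ring_nf

lemma integrable_shiftDensity_mul_shiftDensity (a b : ι → ℝ) :
    Integrable (fun x => shiftDensity a x * shiftDensity b x) (gaussianShift 0) := by
  simp only [shiftDensity_mul_shiftDensity]
  exact (integrable_shiftDensity _).const_mul _

lemma integral_shiftDensity_mul_shiftDensity (a b : ι → ℝ) :
    ∫ x, shiftDensity a x * shiftDensity b x ∂gaussianShift 0 = Real.exp (a ⬝ᵥ b) := by
  simp only [shiftDensity_mul_shiftDensity, integral_const_mul, integral_shiftDensity, mul_one]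

lemma memLp_two_shiftDensity (a : ι → ℝ) : MemLp (shiftDensity a) 2 (gaussianShift 0) := by
  rw [memLp_two_iff_integrable_sq (measurable_shiftDensity a).aestronglyMeasurable]
  simpa only [sq] using integrable_shiftDensity_mul_shiftDensity a a

lemma hasSubgaussianMGF_sum_sub_gaussianShift (a : ι → ℝ) (S : Finset ι) :
    HasSubgaussianMGF (fun x => ∑ i ∈ S, (x i - a i)) #S (gaussianShift a) := by
  have hindep : iIndepFun (fun i (x : ι → ℝ) => x i - a i) (gaussianShift a) :=
    iIndepFun_pi (X := fun i y => y - a i) fun i => by fun_prop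
  have hcoord (i : ι) : HasSubgaussianMGF (fun x : ι → ℝ => x i - a i) 1 (gaussianShift a) := by
    refine .of_map (Y := fun x : ι → ℝ => x i) (X := fun y => y - a i)
      (measurable_pi_apply i).aemeasurable ?_
    have hmarginal : (gaussianShift a).map (fun x => x i) = gaussianReal (a i) 1 :=
      (measurePreserving_eval _ i).map_eq
    rw [hmarginal]
    exact hasSubgaussianMGF_sub_mean_gaussianReal (a i) 1
  simpa using HasSubgaussianMGF.sum_of_iIndepFun hindep (s := S) fun i _ => hcoord i

lemma gaussianShift_real_ge_le (a : ι → ℝ) (S : Finset ι) {ε : ℝ} (hε : 0 ≤ ε) :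
    (gaussianShift a).real {x | ε ≤ ∑ i ∈ S, (x i - a i)} ≤ Real.exp (-ε ^ 2 / (2 * #S)) :=
  (hasSubgaussianMGF_sum_sub_gaussianShift a S).measure_ge_le hε

lemma gaussianShift_real_le_neg_le (a : ι → ℝ) (S : Finset ι) {ε : ℝ} (hε : 0 ≤ ε) :
    (gaussianShift a).real {x | ∑ i ∈ S, (x i - a i) ≤ -ε} ≤ Real.exp (-ε ^ 2 / (2 * #S)) := by
  simpa only [Pi.neg_apply, le_neg, NNReal.coe_natCast] using
    (hasSubgaussianMGF_sum_sub_gaussianShift a S).neg.measure_ge_le hε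

end GaussianShift

section Overlap

lemma exp_mul_le_chord {c z k : ℝ} (hk : 0 < k) (hz : 0 ≤ z) (hzk : z ≤ k) :
    Real.exp (c * z) ≤ 1 + z / k * (Real.exp (c * k) - 1) := by
  have h := convexOn_exp.2 (Set.mem_univ (0 : ℝ)) (Set.mem_univ (c * k))
    (sub_nonneg.2 ((div_le_one hk).2 hzk)) (div_nonneg hz hk.le) (sub_add_cancel 1 (z / k))
  have hpoint : z / k * (c * k) = c * z := by field_simp
  simp only [smul_eq_mul, mul_zero, zero_add, Real.exp_zero, mul_one, hpoint] at h
  linarith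

variable {n : ℕ} {C : Finset (Finset (Fin n))} {T : Finset (Fin n)} {c p : ℝ}

lemma uniformLaw_real_mem (C : Finset (Finset (Fin n))) (i : Fin n) :
    (uniformLaw C).real {S | i ∈ S} = (#{S ∈ C | i ∈ S} : ℝ) / #C := by
  have : MeasurableSingletonClass (Finset (Fin n)) := ⟨fun _ => trivial⟩
  have hset : (C : Set (Finset (Fin n))) ∩ {S | i ∈ S} = ({S ∈ C | i ∈ S} : Finset _) := by
    rw [Finset.coe_filter]
    rfl
  rw [uniformLaw, measureReal_def, ← uniformOn_inter_self C.finite_toSet, hset,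
    uniformOn_apply_finset, Finset.inter_eq_right.2 (Finset.filter_subset _ _), ENNReal.toReal_div,
    ENNReal.toReal_natCast, ENNReal.toReal_natCast]

lemma sum_card_inter_eq_card_mul_sum_uniformLaw (hC : C.Nonempty) (T : Finset (Fin n)) :
    ∑ S ∈ C, (#(T ∩ S) : ℝ) = #C * ∑ i ∈ T, (uniformLaw C).real {S | i ∈ S} := by
  have hN : (#C : ℝ) ≠ 0 := Nat.cast_ne_zero.2 hC.card_pos.ne'
  have hcount : ∑ S ∈ C, #(T ∩ S) = ∑ i ∈ T, #{S ∈ C | i ∈ S} := by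
    simp only [← Finset.filter_mem_eq_inter]
    exact (Finset.sum_card_bipartiteAbove_eq_sum_card_bipartiteBelow _).symm
  simp only [uniformLaw_real_mem, ← Finset.sum_div]
  rw [mul_div_cancel₀ _ hN]
  exact_mod_cast hcount

lemma sum_exp_card_inter_le (hC : C.Nonempty) (hT : T.Nonempty) (hc : 0 ≤ c)
    (hp : ∀ i ∈ T, (uniformLaw C).real {S | i ∈ S} ≤ p) :
    ∑ S ∈ C, Real.exp (c * #(T ∩ S)) ≤ #C * (1 + p * (Real.exp (c * #T) - 1)) := by
  have hT0 : (0 : ℝ) < #T := Nat.cast_pos.2 hT.card_pos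
  have hexp : 0 ≤ Real.exp (c * #T) - 1 := sub_nonneg.2 (Real.one_le_exp (by positivity))
  calc ∑ S ∈ C, Real.exp (c * #(T ∩ S))
      ≤ ∑ S ∈ C, (1 + (#(T ∩ S) : ℝ) / #T * (Real.exp (c * #T) - 1)) :=
        Finset.sum_le_sum fun S _ => exp_mul_le_chord hT0 (Nat.cast_nonneg _)
          (Nat.cast_le.2 (Finset.card_le_card Finset.inter_subset_left))
    _ = #C * (1 + (∑ i ∈ T, (uniformLaw C).real {S | i ∈ S}) / #T * (Real.exp (c * #T) - 1)) := by
        rw [Finset.sum_add_distrib, ← Finset.sum_mul, ← Finset.sum_div,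
          sum_card_inter_eq_card_mul_sum_uniformLaw hC, Finset.sum_const, nsmul_eq_mul]
        ring
    _ ≤ #C * (1 + p * (Real.exp (c * #T) - 1)) := by
        gcongr
        rw [div_le_iff₀' hT0, ← nsmul_eq_mul]
        exact Finset.sum_le_card_nsmul _ _ _ hp

end Overlap

section LikelihoodRatio

variable {n : ℕ} {C : Finset (Finset (Fin n))} {μ : ℝ} {f : (Fin n → ℝ) → Fin 2}

/-- The mean vector of the observation under `altLaw μ S`. -/
def signal (μ : ℝ) (S : Finset (Fin n)) (i : Fin n) : ℝ := if i ∈ S then μ else 0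

instance : IsProbabilityMeasure (nullLaw n) :=
  inferInstanceAs (IsProbabilityMeasure (gaussianShift fun _ => 0))

lemma altLaw_eq_gaussianShift (μ : ℝ) (S : Finset (Fin n)) :
    altLaw μ S = gaussianShift (signal μ S) := rfl

lemma nullLaw_eq_gaussianShift : nullLaw n = gaussianShift 0 := rfl

lemma signal_dotProduct_signal (μ : ℝ) (S T : Finset (Fin n)) :
    signal μ S ⬝ᵥ signal μ T = μ ^ 2 * #(S ∩ T) := by
  have hterm (i : Fin n) : signal μ S i * signal μ T i = if i ∈ S ∩ T then μ ^ 2 else 0 := by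
    simp only [signal, Finset.mem_inter, ite_and]
    split_ifs <;> ring
  simp only [dotProduct, hterm, Finset.sum_ite_mem, Finset.univ_inter, Finset.sum_const,
    nsmul_eq_mul, mul_comm]

lemma likelihoodRatio_eq (C : Finset (Finset (Fin n))) (μ : ℝ) (x : Fin n → ℝ) :
    likelihoodRatio C μ x = 1 / #C * ∑ S ∈ C, shiftDensity (signal μ S) x := by
  have hnull : nullDensity x ≠ 0 :=
    Finset.prod_ne_zero_iff.2 fun i _ => (gaussianPDFReal_pos 0 1 (x i) one_ne_zero).ne'
  have halt (S : Finset (Fin n)) :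
      altDensity μ S x = nullDensity x * shiftDensity (signal μ S) x :=
    prod_gaussianPDFReal_eq_mul_shiftDensity (signal μ S) x
  simp only [likelihoodRatio, halt, ← Finset.mul_sum]
  field_simp

lemma memLp_two_likelihoodRatio (C : Finset (Finset (Fin n))) (μ : ℝ) :
    MemLp (likelihoodRatio C μ) 2 (nullLaw n) := by
  simp only [funext (likelihoodRatio_eq C μ)]
  exact (memLp_finsetSum C fun S _ => memLp_two_shiftDensity (signal μ S)).const_mul _

lemma integrable_likelihoodRatio (C : Finset (Finset (Fin n))) (μ : ℝ) :
    Integrable (likelihoodRatio C μ) (nullLaw n) :=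
  (memLp_two_likelihoodRatio C μ).integrable one_le_two

@[fun_prop]
lemma measurable_likelihoodRatio (C : Finset (Finset (Fin n))) (μ : ℝ) :
    Measurable (likelihoodRatio C μ) := by
  simp only [funext (likelihoodRatio_eq C μ)]
  fun_prop

lemma setIntegral_likelihoodRatio (C : Finset (Finset (Fin n))) (μ : ℝ) {A : Set (Fin n → ℝ)}
    (hA : MeasurableSet A) :
    ∫ x in A, likelihoodRatio C μ x ∂nullLaw n = 1 / #C * ∑ S ∈ C, (altLaw μ S).real A := by
  simp only [likelihoodRatio_eq, altLaw_eq_gaussianShift, nullLaw_eq_gaussianShift,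
    gaussianShift_real_eq_setIntegral _ hA]
  rw [integral_const_mul, integral_finsetSum C fun S _ =>
    (integrable_shiftDensity (signal μ S)).integrableOn]

lemma integral_likelihoodRatio (hC : C.Nonempty) (μ : ℝ) :
    ∫ x, likelihoodRatio C μ x ∂nullLaw n = 1 := by
  have hN : (#C : ℝ) ≠ 0 := Nat.cast_ne_zero.2 hC.card_pos.ne'
  rw [← setIntegral_univ, setIntegral_likelihoodRatio C μ .univ]
  simp only [altLaw_eq_gaussianShift, probReal_univ, Finset.sum_const, nsmul_eq_mul, mul_one,
    one_div_mul_cancel hN]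

lemma integral_likelihoodRatio_sq (C : Finset (Finset (Fin n))) (μ : ℝ) :
    ∫ x, likelihoodRatio C μ x ^ 2 ∂nullLaw n =
      (1 / #C) ^ 2 * ∑ S ∈ C, ∑ T ∈ C, Real.exp (μ ^ 2 * #(S ∩ T)) := by
  have hint (S T : Finset (Fin n)) :=
    integrable_shiftDensity_mul_shiftDensity (signal μ S) (signal μ T)
  simp only [likelihoodRatio_eq, mul_pow, sq (Finset.sum C _), Finset.sum_mul_sum,
    nullLaw_eq_gaussianShift, integral_const_mul]
  rw [integral_finsetSum C fun _ _ => integrable_finsetSum C fun _ _ => hint _ _]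
  simp only [integral_finsetSum C fun _ _ => hint _ _, integral_shiftDensity_mul_shiftDensity,
    signal_dotProduct_signal]

lemma risk_eq_real_add_setIntegral (C : Finset (Finset (Fin n))) (μ : ℝ) (hf : Measurable f) :
    risk C μ f = ∫ _ in {x | f x = 1}, 1 ∂nullLaw n +
      ∫ x in {x | f x = 1}ᶜ, likelihoodRatio C μ x ∂nullLaw n := by
  have hreject : MeasurableSet {x | f x = 1} := hf (measurableSet_singleton 1)
  have haccept : {x | f x = 0} = {x | f x = 1}ᶜ := by
    ext x
    simp only [Set.mem_ofPred_eq, Set.mem_compl_iff]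
    lia
  rw [risk, haccept, setIntegral_likelihoodRatio C μ hreject.compl, setIntegral_const,
    smul_eq_mul, mul_one]

lemma measurable_optimalTest (C : Finset (Finset (Fin n))) (μ : ℝ) :
    Measurable (optimalTest C μ) :=
  Measurable.ite (measurableSet_lt measurable_const (by fun_prop)) measurable_const
    measurable_const

lemma bayesRisk_eq_integral_min (C : Finset (Finset (Fin n))) (μ : ℝ) :
    bayesRisk C μ = ∫ x, min 1 (likelihoodRatio C μ x) ∂nullLaw n := by
  have hreject : {x | optimalTest C μ x = 1} = {x | 1 < likelihoodRatio C μ x} := by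
    ext x
    simp [optimalTest]
  rw [bayesRisk, risk_eq_real_add_setIntegral C μ (measurable_optimalTest C μ), hreject,
    integral_min_eq_setIntegral_add_compl (integrable_const 1) (integrable_likelihoodRatio C μ)
      (measurableSet_lt measurable_const (by fun_prop))]

lemma bayesRisk_le_risk (C : Finset (Finset (Fin n))) (μ : ℝ) (hf : Measurable f) :
    bayesRisk C μ ≤ risk C μ f := by
  rw [bayesRisk_eq_integral_min, risk_eq_real_add_setIntegral C μ hf]
  exact integral_min_le_setIntegral_add_compl (integrable_const 1)
    (integrable_likelihoodRatio C μ) (hf (measurableSet_singleton 1))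

end LikelihoodRatio

section LowerBound

variable {n K : ℕ} {C : Finset (Finset (Fin n))} {μ : ℝ}

lemma one_sub_sqrt_overlap_div_two_le_bayesRisk (hC : C.Nonempty) (μ : ℝ) :
    1 - √((1 / #C) ^ 2 * ∑ S ∈ C, ∑ T ∈ C, Real.exp (μ ^ 2 * #(S ∩ T)) - 1) / 2 ≤
      bayesRisk C μ := by
  have hL2 := memLp_two_likelihoodRatio C μ
  have hmean := integral_likelihoodRatio hC μ
  have hvar : Var[likelihoodRatio C μ; nullLaw n] =
      (1 / #C) ^ 2 * ∑ S ∈ C, ∑ T ∈ C, Real.exp (μ ^ 2 * #(S ∩ T)) - 1 := by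
    rw [variance_eq_sub hL2, hmean, one_pow, ← integral_likelihoodRatio_sq]
    rfl
  rw [← hvar, bayesRisk_eq_integral_min]
  exact one_sub_sqrt_variance_div_two_le_integral_min hL2 hmean

lemma half_le_bayesRisk (hK : 1 ≤ K) (hC : C.Nonempty) (hcard : ∀ S ∈ C, #S = K)
    (hincl : ∀ S ∈ C, ∀ i ∈ S, (uniformLaw C).real {S | i ∈ S} ≤ (K : ℝ) / n)
    (hμ : Real.exp (μ ^ 2 * K) ≤ 1 + (n : ℝ) / K) : 1 / 2 ≤ bayesRisk C μ := by
  have hN : (#C : ℝ) ≠ 0 := Nat.cast_ne_zero.2 hC.card_pos.ne'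
  have hgain : (K : ℝ) / n * (Real.exp (μ ^ 2 * K) - 1) ≤ 1 := by
    calc (K : ℝ) / n * (Real.exp (μ ^ 2 * K) - 1) ≤ (K : ℝ) / n * (n / K) := by
          gcongr
          linarith
      _ ≤ 1 := by
        rw [← inv_div]
        exact inv_mul_le_one
  have hoverlap : ∀ S ∈ C, ∑ T ∈ C, Real.exp (μ ^ 2 * #(S ∩ T)) ≤ #C * 2 := fun S hS => by
    have h := sum_exp_card_inter_le hC (Finset.card_pos.1 (hK.trans_eq (hcard S hS).symm))
      (sq_nonneg μ) (hincl S hS)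
    rw [hcard S hS] at h
    exact h.trans (by gcongr; linarith)
  have hsecond : (1 / #C) ^ 2 * ∑ S ∈ C, ∑ T ∈ C, Real.exp (μ ^ 2 * #(S ∩ T)) ≤ 2 := by
    calc (1 / #C) ^ 2 * ∑ S ∈ C, ∑ T ∈ C, Real.exp (μ ^ 2 * #(S ∩ T))
        ≤ (1 / #C : ℝ) ^ 2 * (#C * (#C * 2)) := by
          rw [← nsmul_eq_mul #C]
          gcongr
          exact Finset.sum_le_card_nsmul _ _ _ hoverlap
      _ = 2 := by field_simp [hN]
  have hsqrt : √((1 / #C) ^ 2 * ∑ S ∈ C, ∑ T ∈ C, Real.exp (μ ^ 2 * #(S ∩ T)) - 1) ≤ 1 :=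
    Real.sqrt_le_one.2 (by linarith)
  linarith [one_sub_sqrt_overlap_div_two_le_bayesRisk hC μ]

end LowerBound

section UpperBound

variable {n K : ℕ} {C : Finset (Finset (Fin n))} {α δ μ τ : ℝ}

/-- The scan test: it rejects the null hypothesis when the components over some `S ∈ C` sum to at
least `τ`. -/
noncomputable def scanTest (C : Finset (Finset (Fin n))) (τ : ℝ) (x : Fin n → ℝ) : Fin 2 :=
  if ∃ S ∈ C, τ ≤ ∑ i ∈ S, x i then 1 else 0

lemma setOf_scanTest_eq_one (C : Finset (Finset (Fin n))) (τ : ℝ) :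
    {x | scanTest C τ x = 1} = ⋃ S ∈ C, {x | τ ≤ ∑ i ∈ S, x i} := by
  ext x
  simp [scanTest]

lemma setOf_scanTest_eq_zero (C : Finset (Finset (Fin n))) (τ : ℝ) :
    {x | scanTest C τ x = 0} = ⋂ S ∈ C, {x | ∑ i ∈ S, x i < τ} := by
  ext x
  simp [scanTest]

lemma measurable_scanTest (C : Finset (Finset (Fin n))) (τ : ℝ) : Measurable (scanTest C τ) := by
  refine Measurable.ite ?_ measurable_const measurable_const
  simp only [← exists_prop, Set.ofPred_exists]
  exact C.measurableSet_biUnion fun S _ => measurableSet_le measurable_const (by fun_prop)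

lemma nullLaw_real_scanTest_eq_one_le (hcard : ∀ S ∈ C, #S = K) (hτ : 0 ≤ τ) :
    (nullLaw n).real {x | scanTest C τ x = 1} ≤ #C * Real.exp (-τ ^ 2 / (2 * K)) := by
  rw [setOf_scanTest_eq_one]
  refine (measureReal_biUnion_finset_le C _).trans ?_
  rw [← nsmul_eq_mul]
  refine Finset.sum_le_card_nsmul _ _ _ fun S hS => ?_
  simpa only [nullLaw_eq_gaussianShift, Pi.zero_apply, sub_zero, hcard S hS] using
    gaussianShift_real_ge_le 0 S hτ

lemma altLaw_real_scanTest_eq_zero_le (hcard : ∀ S ∈ C, #S = K) (hτ : τ ≤ K * μ)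
    {S : Finset (Fin n)} (hS : S ∈ C) :
    (altLaw μ S).real {x | scanTest C τ x = 0} ≤ Real.exp (-(K * μ - τ) ^ 2 / (2 * K)) := by
  have hmean : ∑ i ∈ S, signal μ S i = K * μ := by
    simp only [signal, Finset.sum_ite_mem, Finset.inter_self, Finset.sum_const, hcard S hS,
      nsmul_eq_mul]
  have hsub : {x | scanTest C τ x = 0} ⊆
      {x | ∑ i ∈ S, (x i - signal μ S i) ≤ -(K * μ - τ)} := by
    rw [setOf_scanTest_eq_zero]
    intro x hx
    have hlt : ∑ i ∈ S, x i < τ := Set.mem_iInter₂.1 hx S hS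
    simp only [Set.mem_ofPred_eq, Finset.sum_sub_distrib, hmean]
    linarith
  have htail := gaussianShift_real_le_neg_le (signal μ S) S (sub_nonneg.2 hτ)
  rw [hcard S hS] at htail
  rw [altLaw_eq_gaussianShift]
  exact (measureReal_mono hsub).trans htail

lemma risk_scanTest_le (hC : C.Nonempty) (hcard : ∀ S ∈ C, #S = K) (hτ : 0 ≤ τ)
    (hτμ : τ ≤ K * μ) :
    risk C μ (scanTest C τ) ≤
      #C * Real.exp (-τ ^ 2 / (2 * K)) + Real.exp (-(K * μ - τ) ^ 2 / (2 * K)) := by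
  have hN : (0 : ℝ) < #C := Nat.cast_pos.2 hC.card_pos
  refine add_le_add (nullLaw_real_scanTest_eq_one_le hcard hτ) ?_
  rw [one_div, inv_mul_le_iff₀ hN, ← nsmul_eq_mul]
  exact Finset.sum_le_card_nsmul _ _ _ fun S hS => altLaw_real_scanTest_eq_zero_le hcard hτμ hS

lemma sqrt_add_le_sqrt_add_sqrt (x y : ℝ) : √(x + y) ≤ √x + √y := by
  have hle (z : ℝ) : z ≤ √z ^ 2 := (le_max_left z 0).trans_eq Real.sq_sqrt'.symm
  refine Real.sqrt_le_iff.2 ⟨by positivity, ?_⟩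
  calc x + y ≤ √x ^ 2 + √y ^ 2 := add_le_add (hle x) (hle y)
    _ ≤ (√x + √y) ^ 2 := by rw [add_sq']; linarith [show 0 ≤ 2 * √x * √y by positivity]

lemma exp_neg_sq_div_le_inv {k x t : ℝ} (hk : 0 < k) (hx : 0 < x)
    (ht : √(2 / k * Real.log x) ≤ t) : Real.exp (-(k * t) ^ 2 / (2 * k)) ≤ x⁻¹ := by
  have hsq : 2 / k * Real.log x ≤ t ^ 2 := (Real.sqrt_le_iff.1 ht).2
  rw [← Real.le_log_iff_exp_le (inv_pos.2 hx), Real.log_inv]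
  calc -(k * t) ^ 2 / (2 * k) = -(k / 2 * t ^ 2) := by field_simp
    _ ≤ -(k / 2 * (2 / k * Real.log x)) := by gcongr
    _ = -Real.log x := by field_simp

lemma bayesRisk_le (hK : 1 ≤ K) (hC : C.Nonempty) (hcard : ∀ S ∈ C, #S = K) (hδ : 0 < δ)
    (hμ : √(2 / K * Real.log #C) + 2 * √(2 / K * Real.log (2 / δ)) ≤ μ) :
    bayesRisk C μ ≤ δ := by
  set u := √(2 / K * Real.log #C)
  set v := √(2 / K * Real.log (2 / δ))
  have hK0 : (0 : ℝ) < K := Nat.cast_pos.2 hK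
  have hN : (0 : ℝ) < #C := Nat.cast_pos.2 hC.card_pos
  have huv : √(2 / K * Real.log (#C * (2 / δ))) ≤ u + v := by
    rw [Real.log_mul hN.ne' (by positivity), mul_add]
    exact sqrt_add_le_sqrt_add_sqrt _ _
  have hv : 0 ≤ v := Real.sqrt_nonneg _
  have hnull : #C * Real.exp (-(K * (u + v)) ^ 2 / (2 * K)) ≤ δ / 2 := by
    calc #C * Real.exp (-(K * (u + v)) ^ 2 / (2 * K)) ≤ #C * (#C * (2 / δ))⁻¹ := by
          gcongr
          exact exp_neg_sq_div_le_inv hK0 (by positivity) huv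
      _ = δ / 2 := by field_simp
  have halt : Real.exp (-(K * μ - K * (u + v)) ^ 2 / (2 * K)) ≤ δ / 2 := by
    rw [← mul_sub, ← inv_div 2 δ]
    exact exp_neg_sq_div_le_inv hK0 (by positivity) (le_sub_iff_add_le'.2 (by linarith))
  calc bayesRisk C μ ≤ risk C μ (scanTest C (K * (u + v))) :=
        bayesRisk_le_risk C μ (measurable_scanTest C _)
    _ ≤ #C * Real.exp (-(K * (u + v)) ^ 2 / (2 * K)) +
          Real.exp (-(K * μ - K * (u + v)) ^ 2 / (2 * K)) :=
        risk_scanTest_le hC hcard (by positivity) (by gcongr; linarith)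
    _ ≤ δ / 2 + δ / 2 := add_le_add hnull halt
    _ = δ := add_halves δ

lemma bayesRisk_le_half (hK : 1 ≤ K) (hC : C.Nonempty) (hcard : ∀ S ∈ C, #S = K)
    (hsize : (#C : ℝ) ≤ (n : ℝ) ^ α)
    (hμ : √(2 * α / K * Real.log n) + √(8 * Real.log 4 / K) ≤ μ) : bayesRisk C μ ≤ 1 / 2 := by
  obtain ⟨S, hS⟩ := hC
  have hn : (0 : ℝ) < n := by
    have := (hK.trans_eq (hcard S hS).symm).trans (card_finset_fin_le S)
    positivity
  have hlog : Real.log #C ≤ α * Real.log n := by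
    rw [← Real.log_rpow hn]
    exact Real.log_le_log (Nat.cast_pos.2 (Finset.card_pos.2 ⟨S, hS⟩)) hsize
  have hscan : √(2 / K * Real.log #C) ≤ √(2 * α / K * Real.log n) := by
    refine Real.sqrt_le_sqrt ?_
    calc 2 / K * Real.log #C ≤ 2 / K * (α * Real.log n) := by gcongr
      _ = 2 * α / K * Real.log n := by ring
  have hconst : 2 * √(2 / K * Real.log (2 / (1 / 2))) = √(8 * Real.log 4 / K) := by
    have hscale : 8 * Real.log 4 / K = 2 ^ 2 * (2 / K * Real.log (2 / (1 / 2))) := by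
      norm_num
      ring
    rw [hscale, Real.sqrt_mul (sq_nonneg (2 : ℝ)), Real.sqrt_sq zero_le_two]
  exact bayesRisk_le hK ⟨S, hS⟩ hcard one_half_pos (by linarith)

end UpperBound

end SubsetDetection

theorem mainTheorem10_general {n K : ℕ} (hK : 1 ≤ K) {C : Finset (Finset (Fin n))}
    (hC : C.Nonempty) (hcard : ∀ S ∈ C, S.card = K)
    (hincl : ∀ S ∈ C, ∀ i ∈ S, (SubsetDetection.uniformLaw C).real {T | i ∈ T} ≤ (K : ℝ) / n)
    {α : ℝ} (hsize : (C.card : ℝ) ≤ (n : ℝ) ^ α) :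
    (∀ μ : ℝ, 0 < μ → μ ≤ Real.sqrt (1 / (K : ℝ) * Real.log (1 + (n : ℝ) / K)) →
      1 / 2 ≤ SubsetDetection.bayesRisk C μ) ∧
    (∀ μ : ℝ,
      Real.sqrt (2 * α / (K : ℝ) * Real.log n) + Real.sqrt (8 * Real.log 4 / (K : ℝ)) ≤ μ →
      SubsetDetection.bayesRisk C μ ≤ 1 / 2) := by
  refine ⟨fun μ hμ0 hμ => ?_, fun μ hμ => SubsetDetection.bayesRisk_le_half hK hC hcard hsize hμ⟩
  have hK0 : (0 : ℝ) < K := Nat.cast_pos.2 hK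
  have hsq : μ ^ 2 * K ≤ Real.log (1 + n / K) := by
    rwa [Real.le_sqrt' hμ0, one_div, ← div_eq_inv_mul, le_div_iff₀ hK0] at hμ
  exact SubsetDetection.half_le_bayesRisk hK hC hcard hincl
    ((Real.le_log_iff_exp_le (by positivity)).1 hsq)

theorem mainTheorem10 (n K : ℕ) (hK : 1 ≤ K) (C : Finset (Finset (Fin n)))
    (hC : C.Nonempty) (hcard : ∀ S ∈ C, S.card = K)
    (hsymm : SubsetDetection.IsSymmetricClass C K)
    (α : ℝ) (hα : 0 < α) (hsize : (C.card : ℝ) ≤ (n : ℝ) ^ α) :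
    (∀ μ : ℝ, 0 < μ → μ ≤ Real.sqrt (1 / (K : ℝ) * Real.log (1 + (n : ℝ) / K)) →
      1 / 2 ≤ SubsetDetection.bayesRisk C μ) ∧
    (∀ μ : ℝ, 0 < μ →
      Real.sqrt (2 * α / (K : ℝ) * Real.log n) + Real.sqrt (8 * Real.log 4 / (K : ℝ)) ≤ μ →
      SubsetDetection.bayesRisk C μ ≤ 1 / 2) := by
  have h := mainTheorem10_general hK hC hcard
    (fun S hS i hi => (hsymm.inclusion S hS i hi).le) hsize
  exact ⟨h.1, fun μ _ => h.2 μ⟩
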